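/- **Setting.** Let $f:\{0,1\}^n\to\{0,1\}$ and let $c\in\mathbb{R}_{\ge 0}^n$ be a cost vector. An *offline* algorithm knows $c$ and is a decision tree, paying $c_k$ to reveal $x_k$; $\mathrm{opt}^{\mathrm{avg}}_0(f,c)$ is the infimum, over all decision trees that compute $f$ without error, of the expected cost on a uniformly random input $x\in\{0,1\}^n$. An *online* algorithm (possibly randomized) with unit investment $\beta>0$ knows $f$ but neither $x$ nor $c$. It starts with the investments $\theta=0\in\mathbb{R}^n$. At each step, depending on what it has seen so far, it either halts and outputs a bit, or picks a coordinate $k$ and increases $\theta_k$ by $\beta$; the bit $x_k$ is revealed once $\theta_k\ge c_k$. Its cost is $\|\theta\|_1$ when it halts ($\infty$ if it never halts). For an integer $w\ge 1$, the Tribes instance of width $w$ has $n=2^w\cdot w$ variables $(x_{i,j})_{i\in[2^w],\,j\in[w]}$ and the function $f(x)=\bigvee_{i=1}^{2^w}\bigwedge_{j=1}^{w}x_{i,j}$; independently for each $i\in[2^w]$, the costs $(c_{i,1},\dots,c_{i,w})$ are a uniformly random permutation of $\{1,\dots,w\}$. An online algorithm is $\varepsilon_0$-error on this instance if, over the random costs,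 a uniformly random input $x$ and its internal randomness, it fails to output $f(x)$ with probability at most $\varepsilon_0$; its expected cost is taken over the same randomness. **Theorem.** 1. There is an absolute constant $C$ such that for every $w\ge 1$ and every realization $c$ of the costs of the width-$w$ Tribes instance, $\mathrm{opt}^{\mathrm{avg}}_0(f,c)\le C\cdot 2^w$. 2. For every $\varepsilon_0\in[0,1/4)$ there is a constant $\kappa>0$, depending only on $\varepsilon_0$, such that for every $w\ge 1$, every $\beta>0$ and every $\varepsilon_0$-error online algorithm with unit investment $\beta$ on the width-$w$ Tribes instance, the expected cost of the algorithm is at least $\kappa\cdot 2^w\cdot w$. Moreover, this expected cost is at least $\kappa\cdot\ln(n)\cdot \mathrm{opt}^{\mathrm{avg}}_0(f,c)$ for every realization $c$ of the costs, where $n=2^w\cdot w$; that is, online and offline costs are separated by a factor $\Omega(\log n)$. -/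

import Mathlib

open MeasureTheory
open scoped NNReal ENNReal

noncomputable section

namespace PricedQuery

/-- Expectation of `g` under the uniform distribution on a finite type. -/
def mean {α : Type*} [Fintype α] (g : α → ℝ≥0∞) : ℝ≥0∞ :=
  (∑ a, g a) / (Fintype.card α : ℝ≥0∞)

/-! ### Offline setting: the costs are known -/

/-- An offline query algorithm for a known cost vector is a decision tree. At `node i t₀ t₁` it
reveals `x i` and continues with `t₀` if the bit is `false`, with `t₁` if it is `true`. -/
inductive DecisionTree (ι : Type*) where
  | leaf (b : Bool) : DecisionTree ι
  | node (i : ι) (t₀ t₁ : DecisionTree ι) : DecisionTree ι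

namespace DecisionTree

variable {ι : Type*}

def eval : DecisionTree ι → (ι → Bool) → Bool
  | leaf b, _ => b
  | node i t₀ t₁, x => if x i then t₁.eval x else t₀.eval x

/-- Total price paid on input `x`: each query to `x i` costs `c i`. -/
def cost (c : ι → ℝ≥0) : DecisionTree ι → (ι → Bool) → ℝ≥0∞
  | leaf _, _ => 0
  | node i t₀ t₁, x => (c i : ℝ≥0∞) + if x i then t₁.cost c x else t₀.cost c x

variable [Fintype ι] [DecidableEq ι]

/-- Probability, over a uniformly random input, that the tree does not output `f x`. -/
def error (f : (ι → Bool) → Bool) (T : DecisionTree ι) : ℝ≥0∞ :=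
  mean fun x : ι → Bool => if T.eval x = f x then 0 else 1

/-- Expected cost on a uniformly random input. -/
def avgCost (c : ι → ℝ≥0) (T : DecisionTree ι) : ℝ≥0∞ :=
  mean fun x : ι → Bool => T.cost c x

end DecisionTree

/-- The offline benchmark: the least expected cost of a query algorithm that computes `f` with
error probability at most `ε`, both on a uniformly random input. -/
def optAvg {ι : Type*} [Fintype ι] [DecidableEq ι]
    (ε : ℝ≥0∞) (f : (ι → Bool) → Bool) (c : ι → ℝ≥0) : ℝ≥0∞ :=
  ⨅ (T : DecisionTree ι) (_ : T.error f ≤ ε), T.avgCost c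

/-! ### Online setting: the costs are unknown -/

/-- A move of an online algorithm: one more unit of investment in `x i`, or stop and answer. -/
inductive Action (ι : Type*) where
  | invest (i : ι) : Action ι
  | halt (b : Bool) : Action ι

instance {ι : Type*} : MeasurableSpace (Action ι) := ⊤

/-- What an online algorithm has seen so far, most recent step first: the variable it invested in,
and `some b` if the investment in that variable had then reached its cost and its value is `b`,
`none` if the variable was still hidden. -/
abbrev History (ι : Type*) := List (ι × Option Bool)

/-- A deterministic online algorithm. Randomized ones are probability measures on this space, which
carries the product `σ`-algebra. -/
abbrev OnlineAlg (ι : Type*) := History ι → Action ι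

variable {ι : Type*} [DecidableEq ι]

/-- The cumulative investment `θ i` when each step invests `β`. -/
def investment (β : ℝ≥0) (h : History ι) (i : ι) : ℝ≥0 :=
  β * ((h.map Prod.fst).count i : ℝ≥0)

/-- One step with unit investment `β` on the hidden (positive) costs `c` and the hidden input `x`;
a halted algorithm stays put. -/
def step (β : ℝ≥0) (c : ι → ℝ≥0) (x : ι → Bool) (A : OnlineAlg ι) (h : History ι) : History ι :=
  match A h with
  | Action.halt _ => h
  | Action.invest i => (i, if c i ≤ investment β h i + β then some (x i) else none) :: h

/-- The history after `t` steps. -/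
def run (β : ℝ≥0) (c : ι → ℝ≥0) (x : ι → Bool) (A : OnlineAlg ι) : ℕ → History ι
  | 0 => []
  | t + 1 => step β c x A (run β c x A t)

/-- The algorithm stops at some time and answers `b`. -/
def Outputs (β : ℝ≥0) (c : ι → ℝ≥0) (x : ι → Bool) (A : OnlineAlg ι) (b : Bool) : Prop :=
  ∃ t, A (run β c x A t) = Action.halt b

variable [Fintype ι]

/-- The total cost: the value of `∑ i, θ i` when the algorithm halts, as the supremum over time of
this nondecreasing quantity. It is `∞` if `β > 0` and the algorithm never halts. -/
def onlineCost (β : ℝ≥0) (c : ι → ℝ≥0) (x : ι → Bool) (A : OnlineAlg ι) : ℝ≥0∞ :=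
  ⨆ t : ℕ, ∑ i, (investment β (run β c x A t) i : ℝ≥0∞)

/-- Probability, over a uniformly random input and the internal randomness, that the randomized
online algorithm `μ` fails to stop with the answer `f x`. -/
def onlineError (β : ℝ≥0) (f : (ι → Bool) → Bool) (c : ι → ℝ≥0)
    (μ : Measure (OnlineAlg ι)) : ℝ≥0∞ :=
  mean fun x : ι → Bool => μ {A | ¬ Outputs β c x A (f x)}

/-- Expected cost over a uniformly random input and the internal randomness. -/
def onlineAvgCost (β : ℝ≥0) (c : ι → ℝ≥0) (μ : Measure (OnlineAlg ι)) : ℝ≥0∞ :=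
  mean fun x : ι → Bool => ∫⁻ A, onlineCost β c x A ∂μ

/-! ### The Tribes instance -/

/-- Indices of the `2 ^ w * w` variables: `(i, j)` is the `j`-th member of the `i`-th tribe. -/
abbrev TribesVar (w : ℕ) := Fin (2 ^ w) × Fin w

/-- The OR of `2 ^ w` disjoint ANDs of `w` variables each. -/
def tribes (w : ℕ) (x : TribesVar w → Bool) : Bool :=
  decide (∃ i, ∀ j, x (i, j) = true)

/-- One permutation for each tribe. -/
abbrev TribesPerms (w : ℕ) := Fin (2 ^ w) → Equiv.Perm (Fin w)

/-- The costs in tribe `i` are `1, …, w` in the order given by the permutation `σ i`. -/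
def tribesCosts {w : ℕ} (σ : TribesPerms w) (p : TribesVar w) : ℝ≥0 :=
  ((σ p.1 p.2 : ℕ) : ℝ≥0) + 1

/-- Error probability of a randomized online algorithm on the random Tribes instance: independent
uniformly random permutations, uniformly random input, internal randomness. -/
def tribesError (w : ℕ) (β : ℝ≥0) (μ : Measure (OnlineAlg (TribesVar w))) : ℝ≥0∞ :=
  mean fun σ : TribesPerms w => onlineError β (tribes w) (tribesCosts σ) μ

/-- Expected cost of a randomized online algorithm on the random Tribes instance. -/
def tribesExpectedCost (w : ℕ) (β : ℝ≥0) (μ : Measure (OnlineAlg (TribesVar w))) : ℝ≥0∞ :=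
  mean fun σ : TribesPerms w => onlineAvgCost β (tribesCosts σ) μ

end PricedQuery

end

open PricedQuery

/-! Write `N = 2 ^ w`. Offline, the cheapest member of each tribe is read first and a tribe is
abandoned at its first `false`. The member of cost `k + 1` is then read with probability at most
`2⁻ᵏ`, so each tribe costs at most `∑ (k + 1) / 2 ^ k ≤ 4` on average.

Online, the cheap members are unknown. Fix a deterministic algorithm, an input and a time `T`, and
suppose a tribe is first opened by revealing `j`, of cost `a`. For every `k` that costs more than
`a` and has received less than `a`, exchanging the costs of `j` and `k` leaves everything seen so
far unchanged, and the algorithm then still puts `a` into `j`. Charging the openings to these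
investments under exchanged costs shows that opening a tribe takes order `w` on average over the
costs (`card_opened_le`).

Many tribes must be opened. If at most `N / 4` are, each unopened tribe is all `true` with
probability `1 / N`, independently, so an answer `false` is wrong at least half of the time
(`two_mul_card_answer_false_le`). The value `false` has probability at least `1/4`, which forces
`1/4 ≤ error + P(more than N / 4 opened)` (`card_tribes_false_le`). By Markov's inequality, `N w ≤ 4
N w · error + 48 · cost`. This is linear in error and cost, so it survives averaging over the
internal randomness (`le_tribesError_add_tribesExpectedCost`). -/

namespace PricedQuery

/-! ### Runs of a deterministic algorithm -/

section Runs

variable {ι : Type*} [DecidableEq ι] {β : ℝ≥0} {c c' : ι → ℝ≥0} {x x' : ι → Bool}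
  {A : OnlineAlg ι}

/-- What an algorithm sees when it invests one more unit in `i` after the history `h`. -/
noncomputable def outcome (β : ℝ≥0) (c : ι → ℝ≥0) (x : ι → Bool) (h : History ι) (i : ι) :
    Option Bool :=
  if c i ≤ investment β h i + β then some (x i) else none

lemma run_succ_of_invest {t : ℕ} {i : ι} (h : A (run β c x A t) = Action.invest i) :
    run β c x A (t + 1) = (i, outcome β c x (run β c x A t) i) :: run β c x A t := by
  simp [run, step, h, outcome]

lemma run_succ_of_halt {t : ℕ} {b : Bool} (h : A (run β c x A t) = Action.halt b) :
    run β c x A (t + 1) = run β c x A t := by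
  simp [run, step, h]

lemma run_suffix_succ (t : ℕ) : run β c x A t <:+ run β c x A (t + 1) := by
  cases h : A (run β c x A t) with
  | invest i => rw [run_succ_of_invest h]; exact List.suffix_cons _ _
  | halt b => rw [run_succ_of_halt h]

lemma run_suffix {s t : ℕ} (hst : s ≤ t) : run β c x A s <:+ run β c x A t := by
  induction t, hst using Nat.le_induction with
  | base => exact List.suffix_refl _
  | succ t _ ih => exact ih.trans (run_suffix_succ t)

lemma run_eq_of_halt {s t : ℕ} {b : Bool} (hst : s ≤ t)
    (h : A (run β c x A s) = Action.halt b) : run β c x A t = run β c x A s := by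
  induction t, hst using Nat.le_induction with
  | base => rfl
  | succ t _ ih => rw [run_succ_of_halt (b := b) (by rw [ih, h]), ih]

lemma investment_cons_self (h : History ι) (i : ι) (o : Option Bool) :
    investment β ((i, o) :: h) i = investment β h i + β := by
  simp [investment, mul_add]

lemma investment_cons_of_ne (h : History ι) {i k : ι} (hki : k ≠ i) (o : Option Bool) :
    investment β ((k, o) :: h) i = investment β h i := by
  simp [investment, hki]

lemma investment_mono {s t : ℕ} (hst : s ≤ t) (i : ι) :
    investment β (run β c x A s) i ≤ investment β (run β c x A t) i := by
  exact mul_le_mul_right (Nat.cast_le.mpr (((run_suffix hst).sublist.map _).count_le i)) β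

lemma outcome_mem_run {s t : ℕ} (hst : s < t) {i : ι} (h : A (run β c x A s) = Action.invest i) :
    (i, outcome β c x (run β c x A s) i) ∈ run β c x A t := by
  refine (run_suffix (Nat.succ_le_of_lt hst)).subset ?_
  rw [run_succ_of_invest h]
  exact List.mem_cons_self

/-- The hidden data influence a deterministic algorithm only through the outcomes it sees, so
indistinguishable outcomes give the same run. Both the exchange of costs and the change of unopened
tribes rest on this. -/
lemma run_congr {t : ℕ}
    (h : ∀ s < t, ∀ i, A (run β c x A s) = Action.invest i →
      outcome β c x (run β c x A s) i = outcome β c' x' (run β c x A s) i) :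
    run β c x A t = run β c' x' A t := by
  induction t with
  | zero => rfl
  | succ t ih =>
    have ih' := ih fun s hs => h s (hs.trans (Nat.lt_succ_self t))
    cases hA : A (run β c x A t) with
    | invest i =>
      rw [run_succ_of_invest hA, run_succ_of_invest (c := c') (x := x') (ih' ▸ hA), ← ih',
        h t (Nat.lt_succ_self t) i hA]
    | halt b => rw [run_succ_of_halt hA, run_succ_of_halt (c := c') (x := x') (ih' ▸ hA), ih']

end Runs

/-! ### The exchange argument: the price of opening a tribe -/

section Opening

variable {w : ℕ} {β : ℝ≥0} {A : OnlineAlg (TribesVar w)}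

/-- Some member of tribe `i` has been revealed. -/
def Opened (h : History (TribesVar w)) (i : Fin (2 ^ w)) : Prop :=
  ∃ j b, ((i, j), some b) ∈ h

/-- The costs of members `j` and `k` of tribe `i` are exchanged. -/
def swapCosts (σ : TribesPerms w) (i : Fin (2 ^ w)) (j k : Fin w) : TribesPerms w :=
  Function.update σ i (σ i * Equiv.swap j k)

lemma swapCosts_swapCosts (σ : TribesPerms w) (i : Fin (2 ^ w)) (j k : Fin w) :
    swapCosts (swapCosts σ i j k) i j k = σ := by
  simp [swapCosts, mul_assoc]

lemma exists_first_reveal {c : TribesVar w → ℝ≥0} {x : TribesVar w → Bool} {T : ℕ}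
    {i : Fin (2 ^ w)} (h : Opened (run β c x A T) i) :
    ∃ s < T, ∃ j, ¬ Opened (run β c x A s) i ∧ A (run β c x A s) = Action.invest (i, j) ∧
      c (i, j) ≤ investment β (run β c x A s) (i, j) + β := by
  induction T with
  | zero =>
    obtain ⟨j, b, h⟩ := h
    simp [run] at h
  | succ T ih =>
    by_cases hT : Opened (run β c x A T) i
    · obtain ⟨s, hs, h'⟩ := ih hT
      exact ⟨s, hs.trans (Nat.lt_succ_self T), h'⟩
    · refine ⟨T, Nat.lt_succ_self T, ?_⟩
      obtain ⟨j, b, hj⟩ := h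
      cases hA : A (run β c x A T) with
      | halt b' =>
        rw [run_succ_of_halt hA] at hj
        exact absurd ⟨j, b, hj⟩ hT
      | invest v =>
        rw [run_succ_of_invest hA, List.mem_cons] at hj
        rcases hj with hj | hj
        · obtain ⟨rfl, ho⟩ := Prod.mk.inj hj
          refine ⟨j, hT, rfl, ?_⟩
          by_contra hc
          simp [outcome, hc] at ho
        · exact absurd ⟨j, b, hj⟩ hT

lemma lt_cost_of_not_opened {c : TribesVar w → ℝ≥0} {x : TribesVar w → Bool} {s t : ℕ}
    {i : Fin (2 ^ w)} (h : ¬ Opened (run β c x A t) i) (hst : s < t) {j : Fin w}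
    (hA : A (run β c x A s) = Action.invest (i, j)) :
    investment β (run β c x A s) (i, j) + β < c (i, j) := by
  by_contra hc
  have := outcome_mem_run hst hA
  rw [outcome, if_pos (not_lt.mp hc)] at this
  exact h ⟨j, _, this⟩

/-- If tribe `i` is opened by revealing `j`, then after exchanging the cost of `j` with a larger cost
of a member that has received little, the algorithm still invests the old cost in `j`. -/
lemma cost_le_investment_swapCosts {σ : TribesPerms w} {x : TribesVar w → Bool} {s T : ℕ}
    (hsT : s < T) {i : Fin (2 ^ w)} {j k : Fin w}
    (hs : ¬ Opened (run β (tribesCosts σ) x A s) i)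
    (hA : A (run β (tribesCosts σ) x A s) = Action.invest (i, j))
    (hj : tribesCosts σ (i, j) ≤ investment β (run β (tribesCosts σ) x A s) (i, j) + β)
    (hk : investment β (run β (tribesCosts σ) x A s) (i, k) < tribesCosts σ (i, j))
    (hjk : σ i j < σ i k) :
    tribesCosts σ (i, j) ≤
      investment β (run β (tribesCosts (swapCosts σ i j k)) x A T) (i, j) := by
  have hne : j ≠ k := by rintro rfl; exact lt_irrefl _ hjk
  have cj : tribesCosts (swapCosts σ i j k) (i, j) = tribesCosts σ (i, k) := by
    simp [tribesCosts, swapCosts]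
  have ck : tribesCosts (swapCosts σ i j k) (i, k) = tribesCosts σ (i, j) := by
    simp [tribesCosts, swapCosts]
  have hlt : tribesCosts σ (i, j) < tribesCosts σ (i, k) := by
    simp only [tribesCosts]
    have : (σ i j : ℕ) < (σ i k : ℕ) := hjk
    gcongr
  -- Nothing in the tribe is revealed before time `s`. Raising the cost of `j` keeps `j` hidden, and
  -- `k` stays hidden under its lowered cost because it has received less than that cost by time
  -- `s`.
  have hrun : run β (tribesCosts σ) x A s = run β (tribesCosts (swapCosts σ i j k)) x A s := by
    refine run_congr fun r hr v hv => ?_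
    by_cases hvj : v = (i, j)
    · subst hvj
      have h1 := lt_cost_of_not_opened hs hr hv
      rw [outcome, outcome, if_neg (not_le.mpr h1), cj, if_neg (not_le.mpr (h1.trans hlt))]
    by_cases hvk : v = (i, k)
    · subst hvk
      have h1 := lt_cost_of_not_opened hs hr hv
      rw [outcome, outcome, if_neg (not_le.mpr h1), ck, if_neg]
      refine not_le.mpr (lt_of_le_of_lt ?_ hk)
      have h2 := investment_mono (β := β) (c := tribesCosts σ) (x := x) (A := A)
        (Nat.succ_le_of_lt hr) (i, k)
      rwa [Nat.succ_eq_add_one, run_succ_of_invest hv, investment_cons_self] at h2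
    · have hc : tribesCosts (swapCosts σ i j k) v = tribesCosts σ v := by
        obtain ⟨i', l⟩ := v
        by_cases hi : i' = i
        · subst hi
          have hlj : l ≠ j := fun h => hvj (by rw [h])
          have hlk : l ≠ k := fun h => hvk (by rw [h])
          simp [tribesCosts, swapCosts, Equiv.swap_apply_of_ne_of_ne hlj hlk]
        · simp [tribesCosts, swapCosts, hi]
      rw [outcome, outcome, hc]
  calc tribesCosts σ (i, j)
      ≤ investment β (run β (tribesCosts (swapCosts σ i j k)) x A s) (i, j) + β := by
        rwa [← hrun]
    _ = investment β (run β (tribesCosts (swapCosts σ i j k)) x A (s + 1)) (i, j) := by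
        rw [run_succ_of_invest (hrun ▸ hA), investment_cons_self]
    _ ≤ _ := investment_mono hsT _

lemma one_le_tribesCosts (σ : TribesPerms w) (p : TribesVar w) : 1 ≤ tribesCosts σ p := by
  simp [tribesCosts]

/-- An opened tribe has either received much, or there are many exchanges of costs after which the
algorithm makes a comparable investment without opening the tribe. -/
lemma Opened.exists_exchanges {σ : TribesPerms w} {x : TribesVar w → Bool} {T : ℕ}
    {i : Fin (2 ^ w)} (h : Opened (run β (tribesCosts σ) x A T) i) :
    ∃ (j : Fin w) (G : Finset (Fin w)),
      (∀ k ∈ G, tribesCosts σ (i, j) ≤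
        investment β (run β (tribesCosts (swapCosts σ i j k)) x A T) (i, j)) ∧
      (w : ℝ≥0) ≤ G.card + 2 * ∑ l, investment β (run β (tribesCosts σ) x A T) (i, l) := by
  obtain ⟨s, hsT, j, hs, hA, hj⟩ := exists_first_reveal h
  set θ := investment β (run β (tribesCosts σ) x A s) with hθ
  set S := ∑ l, investment β (run β (tribesCosts σ) x A T) (i, l) with hS
  refine ⟨j, Finset.filter (fun k => θ (i, k) < tribesCosts σ (i, j) ∧ σ i j < σ i k) Finset.univ,
    fun k hk => ?_, ?_⟩
  · simp only [Finset.mem_filter, Finset.mem_univ, true_and] at hk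
    exact cost_le_investment_swapCosts hsT hs hA hj hk.1 hk.2
  -- A member outside `G` has either received at least the cost of `j` or costs no more than `j`.
  -- Each of these two classes has at most `S` members, whence the factor 2.
  · have hcover : (Finset.univ : Finset (Fin w)) ⊆
        Finset.filter (fun k => θ (i, k) < tribesCosts σ (i, j) ∧ σ i j < σ i k) Finset.univ ∪
          (Finset.filter (fun k => tribesCosts σ (i, j) ≤ θ (i, k)) Finset.univ ∪
            Finset.filter (fun k => σ i k ≤ σ i j) Finset.univ) := by
      intro k _
      simp only [Finset.mem_union, Finset.mem_filter, Finset.mem_univ, true_and]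
      by_cases h1 : θ (i, k) < tribesCosts σ (i, j)
      · by_cases h2 : σ i j < σ i k
        · exact Or.inl ⟨h1, h2⟩
        · exact Or.inr (Or.inr (not_lt.mp h2))
      · exact Or.inr (Or.inl (not_lt.mp h1))
    have hcard := (Finset.card_le_card hcover).trans ((Finset.card_union_le _ _).trans
      (Nat.add_le_add_left (Finset.card_union_le _ _) _))
    rw [Finset.card_univ, Fintype.card_fin] at hcard
    have h1 : ((Finset.filter (fun k => tribesCosts σ (i, j) ≤ θ (i, k)) Finset.univ).card : ℝ≥0)
        ≤ S := by
      rw [Finset.cast_card, Finset.sum_filter]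
      refine Finset.sum_le_sum fun k _ => ?_
      split_ifs with hk
      · exact ((one_le_tribesCosts σ _).trans hk).trans (investment_mono hsT.le _)
      · exact zero_le
    -- The costs in a tribe are exactly `1, …, w`, so the number of members costing at most as much
    -- as `j` is the cost of `j`, which `j` itself has received after step `s`.
    have h2 : ((Finset.filter (fun k => σ i k ≤ σ i j) Finset.univ).card : ℝ≥0) ≤ S := by
      have he : (Finset.filter (fun k => σ i k ≤ σ i j) Finset.univ).card = (σ i j : ℕ) + 1 := by
        rw [← Fin.card_Iic]
        refine Finset.card_equiv (σ i) fun k => ?_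
        simp
      rw [he]
      calc (((σ i j : ℕ) + 1 : ℕ) : ℝ≥0) = tribesCosts σ (i, j) := by simp [tribesCosts]
        _ ≤ investment β (run β (tribesCosts σ) x A (s + 1)) (i, j) := by
          rwa [run_succ_of_invest hA, investment_cons_self]
        _ ≤ investment β (run β (tribesCosts σ) x A T) (i, j) := investment_mono hsT _
        _ ≤ S := Finset.single_le_sum
          (f := fun l => investment β (run β (tribesCosts σ) x A T) (i, l))
          (fun _ _ => zero_le) (Finset.mem_univ j)
    refine (Nat.cast_le.mpr hcard).trans ?_
    push_cast
    rw [two_mul]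
    exact add_le_add le_rfl (add_le_add h1 h2)

lemma card_filter_succ_le (w : ℕ) (a : ℝ≥0) :
    ((Finset.filter (fun t : Fin w => ((t : ℕ) : ℝ≥0) + 1 ≤ a) Finset.univ).card : ℝ≥0) ≤ a := by
  have h : (Finset.filter (fun t : Fin w => ((t : ℕ) : ℝ≥0) + 1 ≤ a) Finset.univ).card ≤
      (Finset.range ⌊a⌋₊).card := by
    refine Finset.card_le_card_of_injOn (fun t => (t : ℕ)) ?_ Fin.val_injective.injOn
    intro t ht
    simp only [Finset.coe_filter, Finset.mem_univ, true_and, Set.mem_ofPred_eq] at ht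
    simp only [Finset.coe_range, Set.mem_Iio]
    exact Nat.le_floor (by exact_mod_cast ht)
  rw [Finset.card_range] at h
  exact (Nat.cast_le.mpr h).trans (Nat.floor_le zero_le)

open Classical in
/-- Over random costs, opening a tribe takes an expected investment of order `w`. -/
lemma card_opened_le (x : TribesVar w → Bool) (T : ℕ) (i : Fin (2 ^ w)) :
    (w : ℝ≥0) * (Finset.filter
        (fun σ : TribesPerms w => Opened (run β (tribesCosts σ) x A T) i) Finset.univ).card ≤
      3 * ∑ σ : TribesPerms w, ∑ l, investment β (run β (tribesCosts σ) x A T) (i, l) := by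
  rcases Nat.eq_zero_or_pos w with hw | hw
  · subst hw
    simp
  set S : TribesPerms w → ℝ≥0 :=
    fun σ => ∑ l, investment β (run β (tribesCosts σ) x A T) (i, l) with hS
  set O := Finset.filter
    (fun σ : TribesPerms w => Opened (run β (tribesCosts σ) x A T) i) Finset.univ with hO
  -- Membership in `O` is placed inside the existential so that `choose` yields total functions. The
  -- default member `0` exists since `w` is positive.
  have hex : ∀ σ : TribesPerms w, ∃ (j : Fin w) (G : Finset (Fin w)), σ ∈ O →
      (∀ k ∈ G, tribesCosts σ (i, j) ≤
        investment β (run β (tribesCosts (swapCosts σ i j k)) x A T) (i, j)) ∧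
      (w : ℝ≥0) ≤ G.card + 2 * S σ := by
    intro σ
    by_cases hσ : σ ∈ O
    · obtain ⟨j, G, h⟩ := Opened.exists_exchanges (Finset.mem_filter.mp hσ).2
      exact ⟨j, G, fun _ => h⟩
    · exact ⟨⟨0, hw⟩, ∅, fun h => absurd h hσ⟩
  choose J G hJG using hex
  -- Double counting: `(σ, k)` is sent to the exchanged costs, the member `j` and the old cost of
  -- `j`. Nothing is lost: in the exchanged costs the old cost of `j` belongs to `k`, so `k` is
  -- recovered, and exchanging back gives `σ`. For given costs and member, the integer costs in the
  -- target number at most the investment in that member.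
  have hcount : ∑ σ ∈ O, ((G σ).card : ℝ≥0) ≤ ∑ σ, S σ := by
    have hinj : (O.sigma G).card ≤ (Finset.univ.sigma fun σ : TribesPerms w =>
        (Finset.univ.sigma fun l : Fin w => Finset.filter (fun t : Fin w => ((t : ℕ) : ℝ≥0) + 1 ≤
          investment β (run β (tribesCosts σ) x A T) (i, l)) Finset.univ)).card := by
      refine Finset.card_le_card_of_injOn
        (fun p => ⟨swapCosts p.1 i (J p.1) p.2, J p.1, p.1 i (J p.1)⟩) ?_ ?_
      · rintro ⟨σ, k⟩ hp
        simp only [Finset.coe_sigma, Set.mem_sigma_iff, Finset.mem_coe] at hp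
        simpa [tribesCosts] using (hJG σ hp.1).1 k hp.2
      · rintro ⟨σ, k⟩ _ ⟨σ', k'⟩ _ heq
        simp only [Sigma.mk.injEq, heq_eq_eq] at heq
        obtain ⟨h1, h2, h3⟩ := heq
        have hk : k = k' := by
          have e1 : swapCosts σ i (J σ) k i k = σ i (J σ) := by simp [swapCosts]
          have e2 : swapCosts σ' i (J σ') k' i k' = σ' i (J σ') := by simp [swapCosts]
          rw [h1, h3, ← e2] at e1
          exact (swapCosts σ' i (J σ') k' i).injective e1
        subst hk
        have hσ : σ = σ' := by
          rw [← swapCosts_swapCosts σ i (J σ) k, h1, h2, swapCosts_swapCosts]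
        rw [hσ]
    calc ∑ σ ∈ O, ((G σ).card : ℝ≥0) = ((O.sigma G).card : ℝ≥0) := by
          rw [Finset.card_sigma, Nat.cast_sum]
      _ ≤ _ := Nat.cast_le.mpr hinj
      _ ≤ ∑ σ, S σ := by
          rw [Finset.card_sigma, Nat.cast_sum]
          refine Finset.sum_le_sum fun σ _ => ?_
          rw [Finset.card_sigma, Nat.cast_sum]
          exact Finset.sum_le_sum fun l _ => card_filter_succ_le w _
  calc (w : ℝ≥0) * O.card = ∑ σ ∈ O, (w : ℝ≥0) := by
        rw [Finset.sum_const, nsmul_eq_mul, mul_comm]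
    _ ≤ ∑ σ ∈ O, ((G σ).card + 2 * S σ) := Finset.sum_le_sum fun σ hσ => (hJG σ hσ).2
    _ = ∑ σ ∈ O, ((G σ).card : ℝ≥0) + 2 * ∑ σ ∈ O, S σ := by
        rw [Finset.sum_add_distrib, Finset.mul_sum]
    _ ≤ ∑ σ, S σ + 2 * ∑ σ, S σ := by
        gcongr
        exact Finset.subset_univ O
    _ = 3 * ∑ σ, S σ := by ring

end Opening

end PricedQuery

namespace PricedQuery

/-! ### Measurability in the algorithm -/

section Measurability

variable {ι : Type*} [DecidableEq ι] [Fintype ι]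

/-- There are countably many histories, so evaluating an algorithm at a history that depends on the
algorithm is still measurable. -/
lemma measurable_run (β : ℝ≥0) (c : ι → ℝ≥0) (x : ι → Bool) (t : ℕ) :
    Measurable[_, ⊤] fun A : OnlineAlg ι => run β c x A t := by
  let _ : MeasurableSpace (History ι) := ⊤
  induction t with
  | zero => exact measurable_const
  | succ t ih =>
    have hstep : Measurable fun p : OnlineAlg ι × History ι => step β c x p.1 p.2 := by
      refine measurable_from_prod_countable_left fun h => ?_
      have : (fun A : OnlineAlg ι => step β c x A h) = (fun a : Action ι => match a with
          | Action.halt _ => h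
          | Action.invest i => (i, if c i ≤ investment β h i + β then some (x i) else none) :: h)
          ∘ fun A => A h := by
        funext A
        rfl
      rw [this]
      exact Measurable.comp measurable_from_top (measurable_pi_apply h)
    exact hstep.comp (measurable_id.prodMk ih)

lemma measurable_onlineCost (β : ℝ≥0) (c : ι → ℝ≥0) (x : ι → Bool) :
    Measurable fun A : OnlineAlg ι => onlineCost β c x A := by
  let _ : MeasurableSpace (History ι) := ⊤
  refine Measurable.iSup fun t => ?_
  exact Measurable.comp
    (g := fun h : History ι => ∑ i, (investment β h i : ℝ≥0∞)) measurable_from_top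
    (measurable_run β c x t)

lemma measurableSet_outputs (β : ℝ≥0) (c : ι → ℝ≥0) (x : ι → Bool) (b : Bool) :
    MeasurableSet {A : OnlineAlg ι | Outputs β c x A b} := by
  let _ : MeasurableSpace (History ι) := ⊤
  have hset : {A : OnlineAlg ι | Outputs β c x A b} =
      ⋃ t, {A | A (run β c x A t) = Action.halt b} := by
    ext A
    simp [Outputs]
  rw [hset]
  refine MeasurableSet.iUnion fun t => ?_
  have happ : Measurable fun p : OnlineAlg ι × History ι => p.1 p.2 :=
    measurable_from_prod_countable_left fun h => measurable_pi_apply h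
  exact (happ.comp (measurable_id.prodMk (measurable_run β c x t)))
    (MeasurableSpace.measurableSet_top (s := {Action.halt b}))

end Measurability

/-! ### The offline upper bound -/

section Offline

variable {ι : Type*}

namespace DecisionTree

/-- Query `v 0, v 1, …` until a `false` shows up; continue with `t` then, answer `true` if none
does. -/
def andTree (t : DecisionTree ι) : (n : ℕ) → (Fin n → ι) → DecisionTree ι
  | 0, _ => leaf true
  | n + 1, v => node (v 0) t (andTree t n fun k => v k.succ)

/-- Evaluate the conjunctions over the rows `v i` one after the other until one of them holds. -/
def orAndTree {n : ℕ} : (m : ℕ) → (Fin m → Fin n → ι) → DecisionTree ι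
  | 0, _ => leaf false
  | m + 1, v => andTree (orAndTree m fun i => v i.succ) n (v 0)

open Classical in
lemma eval_andTree (t : DecisionTree ι) (n : ℕ) (v : Fin n → ι) (x : ι → Bool) :
    (andTree t n v).eval x = if ∀ k, x (v k) = true then true else t.eval x := by
  induction n with
  | zero => simp [andTree, eval]
  | succ n ih =>
    rw [andTree, eval, ih]
    by_cases h : x (v 0) = true
    · simp [h, Fin.forall_fin_succ]
    · simp [h, Fin.forall_fin_succ]

lemma eval_orAndTree {n : ℕ} (m : ℕ) (v : Fin m → Fin n → ι) (x : ι → Bool) :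
    (orAndTree m v).eval x = decide (∃ i, ∀ k, x (v i k) = true) := by
  induction m with
  | zero => simp [orAndTree, eval]
  | succ m ih =>
    rw [orAndTree, eval_andTree, ih]
    by_cases h : ∀ k, x (v 0 k) = true
    · simp [h, Fin.exists_fin_succ]
    · simp only [h, if_false, Fin.exists_fin_succ, false_or]

/-- A member is paid for only if all earlier ones are `true`. The cost of `t` is charged even when
the conjunction holds and `t` is skipped; this makes the bound additive over the tribes. -/
lemma cost_andTree_le (c : ι → ℝ≥0) (t : DecisionTree ι) (n : ℕ) (v : Fin n → ι)
    (x : ι → Bool) :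
    (andTree t n v).cost c x ≤
      ∑ k, (if ∀ l < k, x (v l) = true then (c (v k) : ℝ≥0∞) else 0) + t.cost c x := by
  induction n with
  | zero => simp [andTree, cost]
  | succ n ih =>
    rw [andTree, cost, Fin.sum_univ_succ, add_assoc]
    refine add_le_add (by simp) ?_
    by_cases h : x (v 0) = true
    · rw [if_pos h]
      refine (ih _).trans (add_le_add (Finset.sum_le_sum fun k _ => le_of_eq ?_) le_rfl)
      congr 1
      simp [Fin.forall_fin_succ, h]
    · rw [if_neg h]
      exact le_add_self

lemma cost_orAndTree_le {n : ℕ} (c : ι → ℝ≥0) (m : ℕ) (v : Fin m → Fin n → ι) (x : ι → Bool) :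
    (orAndTree m v).cost c x ≤
      ∑ i, ∑ k, (if ∀ l < k, x (v i l) = true then (c (v i k) : ℝ≥0∞) else 0) := by
  induction m with
  | zero => simp [orAndTree, cost]
  | succ m ih =>
    rw [orAndTree, Fin.sum_univ_succ]
    exact (cost_andTree_le c _ n _ x).trans (add_le_add le_rfl (ih _))

end DecisionTree

lemma two_pow_mul_card_forall_true [Fintype ι] [DecidableEq ι] (S : Finset ι) :
    2 ^ S.card * (Finset.filter (fun x : ι → Bool => ∀ i ∈ S, x i = true) Finset.univ).card =
      Fintype.card (ι → Bool) := by
  have h : Finset.filter (fun x : ι → Bool => ∀ i ∈ S, x i = true) Finset.univ =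
      Fintype.piFinset fun i => if i ∈ S then {true} else Finset.univ := by
    ext x
    simp only [Finset.mem_filter, Finset.mem_univ, true_and, Fintype.mem_piFinset]
    refine forall_congr' fun i => ?_
    by_cases hi : i ∈ S <;> simp [hi]
  rw [h, Fintype.card_piFinset]
  simp only [apply_ite Finset.card, Finset.card_singleton, Finset.card_univ, Fintype.card_bool]
  rw [Finset.prod_ite]
  simp only [Finset.prod_const_one, one_mul, Finset.prod_const]
  rw [← pow_add, Fintype.card_fun, Fintype.card_bool]
  congr 1
  have := Finset.card_filter_add_card_filter_not (s := (Finset.univ : Finset ι)) (fun i => i ∈ S)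
  simpa using this

lemma mean_forall_true [Fintype ι] [DecidableEq ι] (S : Finset ι) (a : ℝ≥0∞) :
    mean (fun x : ι → Bool => if ∀ i ∈ S, x i = true then a else 0) = a / 2 ^ S.card := by
  have h := two_pow_mul_card_forall_true S
  unfold mean
  rw [← Finset.sum_filter, Finset.sum_const, nsmul_eq_mul, ← h]
  push_cast
  have h0 : (Finset.filter (fun x : ι → Bool => ∀ i ∈ S, x i = true) Finset.univ).card ≠ 0 := by
    intro h0
    rw [h0, mul_zero] at h
    exact Fintype.card_ne_zero h.symm
  rw [mul_comm (2 ^ S.card : ℝ≥0∞)]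
  exact ENNReal.mul_div_mul_left _ _ (by exact_mod_cast h0) (ENNReal.natCast_ne_top _)

lemma mean_mono {α : Type*} [Fintype α] {g h : α → ℝ≥0∞} (H : ∀ a, g a ≤ h a) :
    mean g ≤ mean h :=
  ENNReal.div_le_div_right (Finset.sum_le_sum fun a _ => H a) _

lemma mean_sum {α κ : Type*} [Fintype α] (s : Finset κ) (g : κ → α → ℝ≥0∞) :
    mean (fun a => ∑ k ∈ s, g k a) = ∑ k ∈ s, mean (g k) := by
  unfold mean
  rw [Finset.sum_comm]
  simp only [div_eq_mul_inv, Finset.sum_mul]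

lemma sum_range_succ_div_two_pow_le (n : ℕ) :
    ∑ k ∈ Finset.range n, ((k : ℝ) + 1) / 2 ^ k ≤ 4 := by
  have h : ∀ n : ℕ, ∑ k ∈ Finset.range n, ((k : ℝ) + 1) / 2 ^ k = 4 - (2 * n + 4) / 2 ^ n := by
    intro n
    induction n with
    | zero => norm_num
    | succ n ih =>
      rw [Finset.sum_range_succ, ih]
      push_cast
      field_simp
      ring
  rw [h]
  have : (0 : ℝ) ≤ (2 * n + 4) / 2 ^ n := by positivity
  linarith

lemma optAvg_tribes_le (w : ℕ) (σ : TribesPerms w) :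
    optAvg 0 (tribes w) (tribesCosts σ) ≤ 4 * 2 ^ w := by
  -- Each row lists its tribe by increasing cost: position `k` has cost `k + 1`.
  set v : Fin (2 ^ w) → Fin w → TribesVar w := fun i k => (i, (σ i).symm k) with hv
  have herr : (DecisionTree.orAndTree (2 ^ w) v).error (tribes w) ≤ 0 := by
    have : ∀ x, (DecisionTree.orAndTree (2 ^ w) v).eval x = tribes w x := by
      intro x
      rw [DecisionTree.eval_orAndTree, tribes]
      congr 1
      refine propext (exists_congr fun i => ?_)
      exact (σ i).symm.forall_congr_left.trans (by simp [hv])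
    simp [DecisionTree.error, mean, this]
  refine (iInf₂_le (f := fun (T : DecisionTree (TribesVar w)) (_ : T.error (tribes w) ≤ 0) =>
    T.avgCost (tribesCosts σ)) _ herr).trans ?_
  have hmean : ∀ (i : Fin (2 ^ w)) (k : Fin w),
      mean (fun x : TribesVar w → Bool =>
        if ∀ l < k, x (v i l) = true then (tribesCosts σ (v i k) : ℝ≥0∞) else 0) =
      ENNReal.ofReal (((k : ℕ) + 1 : ℝ) / 2 ^ (k : ℕ)) := by
    intro i k
    have hinj : Function.Injective (v i) := fun a b hab =>
      (σ i).symm.injective (Prod.mk.inj hab).2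
    have h := mean_forall_true ((Finset.Iio k).image (v i)) (tribesCosts σ (v i k) : ℝ≥0∞)
    rw [Finset.card_image_of_injective _ hinj, Fin.card_Iio] at h
    simp only [Finset.forall_mem_image, Finset.mem_Iio] at h
    rw [h, ENNReal.ofReal_div_of_pos (by positivity), ENNReal.ofReal_pow (by norm_num)]
    congr 1
    · rw [ENNReal.ofReal_add (by positivity) (by norm_num)]
      simp [tribesCosts, hv]
    · simp
  calc (DecisionTree.orAndTree (2 ^ w) v).avgCost (tribesCosts σ)
      ≤ mean fun x : TribesVar w → Bool => ∑ i, ∑ k,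
          if ∀ l < k, x (v i l) = true then (tribesCosts σ (v i k) : ℝ≥0∞) else 0 :=
        mean_mono fun x => DecisionTree.cost_orAndTree_le _ _ _ x
    _ = ∑ i : Fin (2 ^ w), ∑ k : Fin w, ENNReal.ofReal (((k : ℕ) + 1 : ℝ) / 2 ^ (k : ℕ)) := by
        rw [mean_sum]
        refine Finset.sum_congr rfl fun i _ => ?_
        rw [mean_sum]
        exact Finset.sum_congr rfl fun k _ => hmean i k
    _ ≤ ∑ i : Fin (2 ^ w), 4 := by
        refine Finset.sum_le_sum fun i _ => ?_
        rw [← ENNReal.ofReal_sum_of_nonneg fun k _ => by positivity,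
          Fin.sum_univ_eq_sum_range (fun k : ℕ => ((k : ℝ) + 1) / 2 ^ k) w]
        exact (ENNReal.ofReal_le_ofReal (sum_range_succ_div_two_pow_le w)).trans (by simp)
    _ = 4 * 2 ^ w := by
        simp [mul_comm]

end Offline

end PricedQuery

namespace PricedQuery

/-! ### An accurate algorithm opens many tribes -/

section Error

variable {w : ℕ} {β : ℝ≥0} {c : TribesVar w → ℝ≥0} {A : OnlineAlg (TribesVar w)}

lemma card_forall_tribe_mem (S : Fin (2 ^ w) → Finset (Fin w → Bool)) :
    (Finset.filter (fun y : TribesVar w → Bool => ∀ i, (fun j => y (i, j)) ∈ S i)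
      Finset.univ).card = ∏ i, (S i).card := by
  rw [← Fintype.card_piFinset]
  refine Finset.card_equiv (Equiv.curry _ _ _) fun y => ?_
  simp only [Finset.mem_filter, Finset.mem_univ, true_and, Fintype.mem_piFinset]
  rfl

lemma tribes_eq_false_iff (x : TribesVar w → Bool) :
    tribes w x = false ↔ ∀ i, (fun j => x (i, j)) ≠ fun _ => true := by
  simp [tribes, funext_iff]

/-- The number of inputs that agree with `x` on the tribes in `O` and whose restrictions to the
other tribes lie in `F`. -/
lemma card_agree (O : Finset (Fin (2 ^ w))) (x : TribesVar w → Bool) (F : Finset (Fin w → Bool)) :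
    (Finset.filter (fun y : TribesVar w → Bool => (∀ i ∈ O, ∀ j, y (i, j) = x (i, j)) ∧
      ∀ i ∉ O, (fun j => y (i, j)) ∈ F) Finset.univ).card = F.card ^ (2 ^ w - O.card) := by
  have h := card_forall_tribe_mem (fun i => if i ∈ O then {fun j => x (i, j)} else F)
  have hprod : ∏ i, (if i ∈ O then {fun j => x (i, j)} else F : Finset (Fin w → Bool)).card =
      F.card ^ (2 ^ w - O.card) := by
    simp only [apply_ite Finset.card, Finset.card_singleton]
    rw [Finset.prod_ite]
    simp only [Finset.prod_const_one, one_mul, Finset.prod_const]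
    congr 1
    have := Finset.card_compl O
    rw [Fintype.card_fin] at this
    rw [← this]
    congr 1
    ext i
    simp
  rw [← hprod, ← h]
  congr 1
  ext y
  simp only [Finset.mem_filter, Finset.mem_univ, true_and]
  constructor
  · rintro ⟨h1, h2⟩ i
    by_cases hi : i ∈ O
    · simpa [hi, funext_iff] using h1 i hi
    · simpa [hi] using h2 i hi
  · intro h
    refine ⟨fun i hi j => ?_, fun i hi => ?_⟩
    · have := h i
      rw [if_pos hi, Finset.mem_singleton] at this
      exact congrFun this j
    · simpa [hi] using h i

/-- `(1 - 1/N) ^ m ≤ exp (-m/N) ≤ exp (-3/4) ≤ 1/2`, since `log 2 < 3/4`. -/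
lemma two_mul_pred_pow_le {N m : ℕ} (hN : 0 < N) (hm : 3 * N ≤ 4 * m) :
    2 * (N - 1) ^ m ≤ N ^ m := by
  have hN' : (0 : ℝ) < N := by exact_mod_cast hN
  have h1 : ((N - 1 : ℕ) : ℝ) = N * (1 - 1 / N) := by
    rw [Nat.cast_sub hN]
    field_simp
    simp
  have h2 : (1 - 1 / (N : ℝ)) ^ m ≤ 1 / 2 := by
    have h0 : 0 ≤ 1 - 1 / (N : ℝ) := by
      rw [sub_nonneg, div_le_one hN']
      exact_mod_cast hN
    calc (1 - 1 / (N : ℝ)) ^ m ≤ Real.exp (-(1 / N)) ^ m := by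
          gcongr
          exact Real.one_sub_le_exp_neg _
      _ = Real.exp (-(m / N)) := by rw [← Real.exp_nat_mul]; congr 1; ring
      _ ≤ Real.exp (-Real.log 2) := by
          have h3 : (3 : ℝ) * N ≤ 4 * m := by exact_mod_cast hm
          have h4 : (3 / 4 : ℝ) ≤ m / N := by rw [le_div_iff₀ hN']; linarith
          have h5 := Real.log_two_lt_d9
          exact Real.exp_le_exp.mpr (by linarith)
      _ = 1 / 2 := by rw [Real.exp_neg, Real.exp_log (by norm_num)]; norm_num
  have h3 : (2 : ℝ) * ((N - 1 : ℕ) : ℝ) ^ m ≤ (N : ℝ) ^ m := by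
    rw [h1, mul_pow]
    have : (0 : ℝ) < (N : ℝ) ^ m := by positivity
    nlinarith
  exact_mod_cast h3

/-- Bernoulli's inequality with exponent `N / 2` gives `(1 - 1/N) ^ (N/2) ≥ 1/2`; then square.
Equality holds at `N = 2`. This constant is the origin of the threshold `1/4` on the error. -/
lemma pow_le_four_mul_pred_pow {N : ℕ} (hN : Even N) (h0 : 0 < N) :
    N ^ N ≤ 4 * (N - 1) ^ N := by
  obtain ⟨M, rfl⟩ := hN
  have hM : 0 < M := by omega
  have hM' : (0 : ℝ) < M := by exact_mod_cast hM
  have h1 : (((M + M) - 1 : ℕ) : ℝ) = (M + M : ℝ) * (1 + -(1 / (M + M))) := by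
    rw [Nat.cast_sub (by omega)]
    push_cast
    field_simp
    ring
  have h2 : 1 / 2 ≤ (1 + -(1 / (M + M : ℝ))) ^ M := by
    refine le_trans (le_of_eq ?_) (one_add_mul_le_pow ?_ M)
    · field_simp
      ring
    · have : 1 / (M + M : ℝ) ≤ 1 := by
        rw [div_le_one (by positivity)]
        have : (1 : ℝ) ≤ M := by exact_mod_cast hM
        linarith
      linarith
  have h3 : ((M + M : ℕ) : ℝ) ^ (M + M) ≤ 4 * (((M + M) - 1 : ℕ) : ℝ) ^ (M + M) := by
    rw [h1, mul_pow, pow_add (1 + -(1 / (M + M : ℝ)))]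
    push_cast
    have h4 : (0 : ℝ) < (M + M : ℝ) ^ (M + M) := by positivity
    have h5 : 1 / 4 ≤ (1 + -(1 / (M + M : ℝ))) ^ M * (1 + -(1 / (M + M : ℝ))) ^ M := by
      nlinarith
    nlinarith
  exact_mod_cast h3

lemma card_ne_true : (Finset.univ.erase (fun _ : Fin w => true)).card = 2 ^ w - 1 := by
  rw [Finset.card_erase_of_mem (Finset.mem_univ _), Finset.card_univ, Fintype.card_fun]
  simp

lemma card_input_le_four_mul_card_tribes_false (hw : 1 ≤ w) :
    Fintype.card (TribesVar w → Bool) ≤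
      4 * (Finset.filter (fun x => tribes w x = false) Finset.univ).card := by
  have h1 := card_agree (w := w) ∅ (fun _ => true) (Finset.univ.erase fun _ => true)
  have h2 : Finset.filter (fun y : TribesVar w → Bool => tribes w y = false) Finset.univ =
      Finset.filter (fun y : TribesVar w → Bool =>
        (∀ i ∈ (∅ : Finset (Fin (2 ^ w))), ∀ j, y (i, j) = true) ∧
        ∀ i ∉ (∅ : Finset (Fin (2 ^ w))), (fun j => y (i, j)) ∈ Finset.univ.erase fun _ => true)
      Finset.univ := by
    ext y
    simp [tribes_eq_false_iff]
  rw [h2, h1, card_ne_true, Finset.card_empty, Nat.sub_zero]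
  refine le_trans (le_of_eq ?_) (pow_le_four_mul_pred_pow (N := 2 ^ w) ?_ (by positivity))
  · simp [← pow_mul, mul_comm]
  · exact (even_two.pow_of_ne_zero (by omega))

open Classical in
/-- The tribes with a revealed member. -/
noncomputable def openedTribes (h : History (TribesVar w)) : Finset (Fin (2 ^ w)) :=
  Finset.filter (fun i => Opened h i) Finset.univ

lemma mem_openedTribes {h : History (TribesVar w)} {i : Fin (2 ^ w)} :
    i ∈ openedTribes h ↔ Opened h i := by
  simp [openedTribes]

lemma run_eq_of_agree {x y : TribesVar w → Bool} {T : ℕ}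
    (h : ∀ i ∈ openedTribes (run β c x A T), ∀ j, y (i, j) = x (i, j)) :
    run β c y A T = run β c x A T := by
  refine (run_congr fun s hs v hv => ?_).symm
  unfold outcome
  split_ifs with hc
  · have hmem := outcome_mem_run hs hv
    rw [outcome, if_pos hc] at hmem
    obtain ⟨i, j⟩ := v
    rw [h i (mem_openedTribes.mpr ⟨j, _, hmem⟩) j]
  · rfl

open Classical in
/-- Among the inputs on which the algorithm has opened at most a quarter of the tribes when it
answers `false`, at most half have the value `false`. -/
lemma two_mul_card_answer_false_le (T : ℕ) :
    2 * (Finset.filter (fun x : TribesVar w → Bool =>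
        (A (run β c x A T) = Action.halt false ∧
          4 * (openedTribes (run β c x A T)).card ≤ 2 ^ w) ∧ tribes w x = false)
        Finset.univ).card ≤
      (Finset.filter (fun x : TribesVar w → Bool =>
        A (run β c x A T) = Action.halt false ∧
          4 * (openedTribes (run β c x A T)).card ≤ 2 ^ w) Finset.univ).card := by
  set P : (TribesVar w → Bool) → Prop := fun x => A (run β c x A T) = Action.halt false ∧
    4 * (openedTribes (run β c x A T)).card ≤ 2 ^ w with hP
  set O : (TribesVar w → Bool) → Finset (Fin (2 ^ w)) :=
    fun x => openedTribes (run β c x A T) with hO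
  -- `φ` keeps the complete opened tribes, including their hidden members. Its fibres are the
  -- classes of inputs agreeing on the opened tribes; the run is constant on each, and the unopened
  -- tribes are free.
  let φ : (TribesVar w → Bool) → TribesVar w → Option Bool :=
    fun x p => if p.1 ∈ O x then some (x p) else none
  have hφ : ∀ x y, φ y = φ x ↔ ∀ i ∈ O x, ∀ j, y (i, j) = x (i, j) := by
    intro x y
    constructor
    · intro h i hi j
      have := congrFun h (i, j)
      simp only [φ, hi, if_true] at this
      split_ifs at this
      exact Option.some.inj this
    · intro h
      have hOy : O y = O x := by simp only [hO, run_eq_of_agree h]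
      funext ⟨i, j⟩
      simp only [φ, hOy]
      split_ifs with hi
      · rw [h i hi j]
      · rfl
  rw [← Finset.filter_filter P (fun x => tribes w x = false) Finset.univ]
  set G := Finset.filter P Finset.univ with hG
  have hmaps : ∀ x ∈ G, φ x ∈ G.image φ := fun x hx => Finset.mem_image_of_mem _ hx
  rw [Finset.card_eq_sum_card_fiberwise (s := G) hmaps,
    Finset.card_eq_sum_card_fiberwise (s := G.filter fun x => tribes w x = false)
      (fun x hx => hmaps x (Finset.mem_filter.mp hx).1), Finset.mul_sum]
  refine Finset.sum_le_sum fun p hp => ?_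
  obtain ⟨x, hx, rfl⟩ := Finset.mem_image.mp hp
  have hPx : P x := (Finset.mem_filter.mp hx).2
  have hm : 3 * 2 ^ w ≤ 4 * (2 ^ w - (O x).card) := by
    have := hPx.2
    simp only [hO]
    omega
  -- With `m` unopened tribes the fibre has `N ^ m` inputs, of which at most `(N - 1) ^ m` have
  -- value `false`.
  have hbig := card_agree (O x) x Finset.univ
  have hsmall := card_agree (O x) x (Finset.univ.erase fun _ => true)
  rw [card_ne_true] at hsmall
  rw [Finset.card_univ, Fintype.card_fun, Fintype.card_bool, Fintype.card_fin] at hbig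
  refine le_trans (Nat.mul_le_mul_left 2 ?_) ((two_mul_pred_pow_le (by positivity) hm).trans ?_)
  · rw [← hsmall]
    refine Finset.card_le_card fun y hy => ?_
    simp only [Finset.mem_filter, Finset.mem_univ, true_and] at hy ⊢
    refine ⟨(hφ x y).mp hy.2, fun i _ => ?_⟩
    simpa using (tribes_eq_false_iff y).mp hy.1.2 i
  · rw [← hbig]
    refine Finset.card_le_card fun y hy => ?_
    simp only [Finset.mem_filter, Finset.mem_univ, true_and] at hy
    have hrun := run_eq_of_agree hy.1
    simp only [hG, Finset.mem_filter, Finset.mem_univ, true_and]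
    refine ⟨?_, (hφ x y).mpr hy.1⟩
    simpa only [hP, hrun] using hPx

open Classical in
/-- To err less often than the answer `true`, an algorithm must open a quarter of the tribes. -/
lemma card_tribes_false_le (T : ℕ) :
    (Finset.filter (fun x => tribes w x = false) Finset.univ).card ≤
      (Finset.filter (fun x => A (run β c x A T) ≠ Action.halt (tribes w x)) Finset.univ).card +
      (Finset.filter (fun x => 2 ^ w < 4 * (openedTribes (run β c x A T)).card)
        Finset.univ).card := by
  let P : (TribesVar w → Bool) → Prop := fun x => A (run β c x A T) = Action.halt false ∧
    4 * (openedTribes (run β c x A T)).card ≤ 2 ^ w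
  let E : (TribesVar w → Bool) → Prop := fun x => A (run β c x A T) ≠ Action.halt (tribes w x)
  have hhalf : 2 * (Finset.filter (fun x => P x ∧ tribes w x = false) Finset.univ).card ≤
      (Finset.filter P Finset.univ).card := by
    convert two_mul_card_answer_false_le (β := β) (c := c) (A := A) T
  have hE : (Finset.filter (fun x => A (run β c x A T) ≠ Action.halt (tribes w x))
      Finset.univ).card = (Finset.filter E Finset.univ).card := by
    congr
  rw [hE]
  have hsplit := Finset.card_filter_add_card_filter_not (s := Finset.filter P Finset.univ)
    (fun x => tribes w x = false)
  rw [Finset.filter_filter, Finset.filter_filter] at hsplit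
  have herr := Finset.card_filter_add_card_filter_not (s := Finset.filter E Finset.univ)
    (fun x => tribes w x = false)
  rw [Finset.filter_filter, Finset.filter_filter] at herr
  -- Correct answers `false` with few opened tribes are at most as numerous as wrong ones, which are
  -- errors on inputs of value `true`. They can thus be traded for errors in the final count.
  have h1 : (Finset.filter (fun x => P x ∧ ¬ tribes w x = false) Finset.univ).card ≤
      (Finset.filter (fun x => E x ∧ ¬ tribes w x = false) Finset.univ).card := by
    refine Finset.card_le_card fun x hx => ?_
    simp only [Finset.mem_filter, Finset.mem_univ, true_and] at hx ⊢
    refine ⟨fun h => hx.2 ?_, hx.2⟩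
    rw [hx.1.1] at h
    exact (Action.halt.inj h).symm
  have h2 : (Finset.filter (fun x => tribes w x = false) Finset.univ).card ≤
      (Finset.filter (fun x => E x ∧ tribes w x = false) Finset.univ).card +
      ((Finset.filter (fun x => P x ∧ tribes w x = false) Finset.univ).card +
      (Finset.filter (fun x => 2 ^ w < 4 * (openedTribes (run β c x A T)).card)
        Finset.univ).card) := by
    refine le_trans (Finset.card_le_card fun x hx => ?_) ((Finset.card_union_le _ _).trans
      (Nat.add_le_add_left (Finset.card_union_le _ _) _))
    simp only [Finset.mem_union, Finset.mem_filter, Finset.mem_univ, true_and] at hx ⊢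
    by_cases hE : E x
    · exact Or.inl ⟨hE, hx⟩
    · by_cases hO : 2 ^ w < 4 * (openedTribes (run β c x A T)).card
      · exact Or.inr (Or.inr hO)
      · refine Or.inr (Or.inl ⟨⟨?_, not_lt.mp hO⟩, hx⟩)
        have := not_not.mp hE
        rwa [hx] at this
  omega

end Error

/-! ### Averaging over costs and inputs at a fixed time -/

section Online

variable {w : ℕ} {β : ℝ≥0}

open Classical in
lemma sum_card_many_opened_le (A : OnlineAlg (TribesVar w)) (x : TribesVar w → Bool) (T : ℕ) :
    (2 ^ w * w : ℝ≥0) * (Finset.filter (fun σ : TribesPerms w =>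
        2 ^ w < 4 * (openedTribes (run β (tribesCosts σ) x A T)).card) Finset.univ).card ≤
      12 * ∑ σ : TribesPerms w, ∑ p, investment β (run β (tribesCosts σ) x A T) p := by
  -- Markov's inequality for the number of opened tribes.
  have h1 : (2 ^ w : ℝ≥0) * (Finset.filter (fun σ : TribesPerms w =>
        2 ^ w < 4 * (openedTribes (run β (tribesCosts σ) x A T)).card) Finset.univ).card ≤
      4 * ∑ σ : TribesPerms w, ((openedTribes (run β (tribesCosts σ) x A T)).card : ℝ≥0) := by
    rw [Finset.cast_card, Finset.sum_filter, Finset.mul_sum, Finset.mul_sum]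
    refine Finset.sum_le_sum fun σ _ => ?_
    split_ifs with h
    · rw [mul_one]
      exact_mod_cast h.le
    · simp
  have h2 : (w : ℝ≥0) *
      ∑ σ : TribesPerms w, ((openedTribes (run β (tribesCosts σ) x A T)).card : ℝ≥0) ≤
      3 * ∑ σ : TribesPerms w, ∑ p, investment β (run β (tribesCosts σ) x A T) p := by
    have h3 : ∑ σ : TribesPerms w, ((openedTribes (run β (tribesCosts σ) x A T)).card : ℝ≥0) =
        ∑ i, ((Finset.filter (fun σ : TribesPerms w =>
          Opened (run β (tribesCosts σ) x A T) i) Finset.univ).card : ℝ≥0) := by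
      simp only [openedTribes, Finset.cast_card, Finset.sum_filter]
      exact Finset.sum_comm
    rw [h3, Finset.mul_sum]
    refine (Finset.sum_le_sum fun i _ => card_opened_le x T i).trans (le_of_eq ?_)
    rw [← Finset.mul_sum, Finset.sum_comm]
    simp only [Fintype.sum_prod_type]
  calc _ = (w : ℝ≥0) * (2 ^ w * (Finset.filter (fun σ : TribesPerms w =>
        2 ^ w < 4 * (openedTribes (run β (tribesCosts σ) x A T)).card) Finset.univ).card) := by ring
    _ ≤ w * (4 * ∑ σ : TribesPerms w,
        ((openedTribes (run β (tribesCosts σ) x A T)).card : ℝ≥0)) := by gcongr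
    _ = 4 * (w * ∑ σ : TribesPerms w,
        ((openedTribes (run β (tribesCosts σ) x A T)).card : ℝ≥0)) := by ring
    _ ≤ 4 * (3 * ∑ σ : TribesPerms w, ∑ p, investment β (run β (tribesCosts σ) x A T) p) := by
        gcongr
    _ = _ := by ring

open Classical in
/-- Error and cost of an algorithm cannot both be small at time `T`. -/
lemma card_le_error_add_cost (hw : 1 ≤ w) (A : OnlineAlg (TribesVar w)) (T : ℕ) :
    (2 ^ w * w : ℝ≥0) * (Fintype.card (TribesPerms w) * Fintype.card (TribesVar w → Bool)) ≤
      4 * (2 ^ w * w) * ∑ σ : TribesPerms w, ∑ x : TribesVar w → Bool,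
        (if A (run β (tribesCosts σ) x A T) ≠ Action.halt (tribes w x) then 1 else 0) +
      48 * ∑ σ : TribesPerms w, ∑ x : TribesVar w → Bool,
        ∑ p, investment β (run β (tribesCosts σ) x A T) p := by
  set M : TribesPerms w → (TribesVar w → Bool) → Prop := fun σ x =>
    2 ^ w < 4 * (openedTribes (run β (tribesCosts σ) x A T)).card with hM
  have h1 : ∀ σ : TribesPerms w, (Fintype.card (TribesVar w → Bool) : ℝ≥0) ≤
      4 * (∑ x : TribesVar w → Bool,
        (if A (run β (tribesCosts σ) x A T) ≠ Action.halt (tribes w x) then 1 else 0) +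
        ∑ x, if M σ x then 1 else 0) := by
    intro σ
    rw [← Finset.sum_filter, ← Finset.sum_filter, ← Finset.cast_card, ← Finset.cast_card]
    exact_mod_cast (card_input_le_four_mul_card_tribes_false hw).trans
      (Nat.mul_le_mul_left 4 (card_tribes_false_le (β := β) (c := tribesCosts σ) (A := A) T))
  have h2 := Finset.sum_le_sum fun (σ : TribesPerms w) (_ : σ ∈ Finset.univ) => h1 σ
  rw [Finset.sum_const, Finset.card_univ, nsmul_eq_mul, ← Finset.mul_sum,
    Finset.sum_add_distrib] at h2
  have h3 : (2 ^ w * w : ℝ≥0) * ∑ σ : TribesPerms w, ∑ x, (if M σ x then 1 else 0) ≤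
      12 * ∑ σ : TribesPerms w, ∑ x : TribesVar w → Bool,
        ∑ p, investment β (run β (tribesCosts σ) x A T) p := by
    rw [Finset.sum_comm, Finset.sum_comm (γ := TribesPerms w), Finset.mul_sum, Finset.mul_sum]
    refine Finset.sum_le_sum fun x _ => ?_
    rw [← Finset.sum_filter, ← Finset.cast_card]
    exact sum_card_many_opened_le A x T
  refine (mul_le_mul_right h2 (2 ^ w * w : ℝ≥0)).trans ?_
  calc _ = 4 * (2 ^ w * w) * ∑ σ : TribesPerms w, ∑ x : TribesVar w → Bool,
        (if A (run β (tribesCosts σ) x A T) ≠ Action.halt (tribes w x) then 1 else 0) +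
        4 * ((2 ^ w * w : ℝ≥0) * ∑ σ : TribesPerms w, ∑ x, (if M σ x then 1 else 0)) := by ring
    _ ≤ 4 * (2 ^ w * w) * ∑ σ : TribesPerms w, ∑ x : TribesVar w → Bool,
        (if A (run β (tribesCosts σ) x A T) ≠ Action.halt (tribes w x) then 1 else 0) +
        4 * (12 * ∑ σ : TribesPerms w, ∑ x : TribesVar w → Bool,
        ∑ p, investment β (run β (tribesCosts σ) x A T) p) := by gcongr
    _ = _ := by ring

end Online

end PricedQuery

namespace PricedQuery

/-! ### Halting, and passage to randomized algorithms -/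

section Halting

variable {ι : Type*} [DecidableEq ι] [Fintype ι] {β : ℝ≥0} {c : ι → ℝ≥0} {x : ι → Bool}
  {A : OnlineAlg ι}

lemma sum_investment (h : History ι) : ∑ i, investment β h i = β * h.length := by
  induction h with
  | nil => simp [investment]
  | cons p h ih =>
    obtain ⟨k, o⟩ := p
    have hcons : ∀ i, investment β ((k, o) :: h) i = investment β h i + if k = i then β else 0 := by
      intro i
      split_ifs with hki
      · subst hki
        exact investment_cons_self h k o
      · rw [investment_cons_of_ne h hki, add_zero]
    simp only [hcons, Finset.sum_add_distrib, ih, Finset.sum_ite_eq, Finset.mem_univ, if_true,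
      List.length_cons]
    push_cast
    ring

lemma sum_investment_le_onlineCost (t : ℕ) :
    ((∑ i, investment β (run β c x A t) i : ℝ≥0) : ℝ≥0∞) ≤ onlineCost β c x A := by
  rw [ENNReal.ofNNReal_finsetSum]
  exact le_iSup (fun t : ℕ => ∑ i, (investment β (run β c x A t) i : ℝ≥0∞)) t

lemma onlineCost_eq_top (hβ : 0 < β) (h : ∀ t b, A (run β c x A t) ≠ Action.halt b) :
    onlineCost β c x A = ⊤ := by
  have hlen : ∀ t, (run β c x A t).length = t := by
    intro t
    induction t with
    | zero => rfl
    | succ t ih =>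
      cases hA : A (run β c x A t) with
      | invest i => rw [run_succ_of_invest hA, List.length_cons, ih]
      | halt b => exact absurd hA (h t b)
  refine ENNReal.eq_top_of_forall_nnreal_le fun r => ?_
  obtain ⟨t, ht⟩ := exists_nat_ge (r / β)
  refine le_trans ?_ (sum_investment_le_onlineCost t)
  rw [sum_investment, hlen, ENNReal.coe_le_coe, mul_comm]
  exact (div_le_iff₀ hβ).mp ht

end Halting

section Online

variable {w : ℕ} {β : ℝ≥0}

open Classical in
/-- Error and cost of a deterministic algorithm cannot both be small. -/
lemma card_le_error_add_onlineCost (hw : 1 ≤ w) (hβ : 0 < β) (A : OnlineAlg (TribesVar w)) :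
    (2 ^ w * w : ℝ≥0∞) * (Fintype.card (TribesPerms w) * Fintype.card (TribesVar w → Bool)) ≤
      4 * (2 ^ w * w) * ∑ σ : TribesPerms w, ∑ x : TribesVar w → Bool,
        {A | ¬ Outputs β (tribesCosts σ) x A (tribes w x)}.indicator 1 A +
      48 * ∑ σ : TribesPerms w, ∑ x : TribesVar w → Bool, onlineCost β (tribesCosts σ) x A := by
  by_cases hhalt : ∀ (σ : TribesPerms w) (x : TribesVar w → Bool),
      ∃ t b, A (run β (tribesCosts σ) x A t) = Action.halt b
  · choose t b htb using hhalt
    -- There are finitely many costs and inputs, so one time `T` lies past every halt and the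
    -- fixed-time bound applies. If some run never halts, its cost is infinite and the bound is
    -- trivial.
    set T := Finset.univ.sup fun p : TribesPerms w × (TribesVar w → Bool) => t p.1 p.2 with hT
    have htT : ∀ σ x, t σ x ≤ T := fun σ x =>
      Finset.le_sup (f := fun p : TribesPerms w × (TribesVar w → Bool) => t p.1 p.2)
        (Finset.mem_univ (σ, x))
    have h := ENNReal.coe_le_coe.mpr (card_le_error_add_cost (β := β) hw A T)
    push_cast at h
    refine h.trans ?_
    gcongr with σ _ x _ σ _ x _
    · by_cases hne : A (run β (tribesCosts σ) x A T) = Action.halt (tribes w x)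
      · simp [hne]
      · rw [if_pos hne, Set.indicator_of_mem, Pi.one_apply]
        · exact ENNReal.coe_one.le
        rintro ⟨s, hs⟩
        have e1 := run_eq_of_halt (htT σ x) (htb σ x)
        apply hne
        rcases le_total s T with hsT | hTs
        · rw [run_eq_of_halt hsT hs, hs]
        · rw [e1]
          rwa [run_eq_of_halt ((htT σ x).trans hTs) (htb σ x)] at hs
    · have := sum_investment_le_onlineCost (β := β) (c := tribesCosts σ) (x := x) (A := A) T
      rwa [ENNReal.ofNNReal_finsetSum] at this
  · push Not at hhalt
    obtain ⟨σ, x, h⟩ := hhalt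
    have htop : ∑ σ : TribesPerms w, ∑ x : TribesVar w → Bool,
        onlineCost β (tribesCosts σ) x A = ⊤ :=
      ENNReal.sum_eq_top.mpr ⟨σ, Finset.mem_univ _,
        ENNReal.sum_eq_top.mpr ⟨x, Finset.mem_univ _, onlineCost_eq_top hβ h⟩⟩
    rw [htop, ENNReal.mul_top (by norm_num), add_top]
    exact le_top

lemma mean_mean {α γ : Type*} [Fintype α] [Fintype γ] (g : α → γ → ℝ≥0∞) :
    mean (fun a => mean (g a)) =
      (∑ a, ∑ b, g a b) / ((Fintype.card α : ℝ≥0∞) * Fintype.card γ) := by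
  unfold mean
  simp only [div_eq_mul_inv]
  rw [← Finset.sum_mul, mul_assoc, ENNReal.mul_inv (Or.inr (ENNReal.natCast_ne_top _))
    (Or.inl (ENNReal.natCast_ne_top _)), mul_comm (Fintype.card γ : ℝ≥0∞)⁻¹]

/-- Error and expected cost of a randomized algorithm cannot both be small. -/
lemma le_tribesError_add_tribesExpectedCost (hw : 1 ≤ w) (hβ : 0 < β)
    (μ : Measure (OnlineAlg (TribesVar w))) [IsProbabilityMeasure μ] :
    (2 ^ w * w : ℝ≥0∞) ≤
      4 * (2 ^ w * w) * tribesError w β μ + 48 * tribesExpectedCost w β μ := by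
  set K : ℝ≥0∞ := (Fintype.card (TribesPerms w) : ℝ≥0∞) * Fintype.card (TribesVar w → Bool)
    with hK
  have hK0 : K ≠ 0 := by simp [hK]
  have hKtop : K ≠ ⊤ := ENNReal.mul_ne_top (ENNReal.natCast_ne_top _) (ENNReal.natCast_ne_top _)
  have herr : tribesError w β μ = (∑ σ : TribesPerms w, ∑ x : TribesVar w → Bool,
      μ {A | ¬ Outputs β (tribesCosts σ) x A (tribes w x)}) / K := mean_mean _
  have hcost : tribesExpectedCost w β μ = (∑ σ : TribesPerms w, ∑ x : TribesVar w → Bool,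
      ∫⁻ A, onlineCost β (tribesCosts σ) x A ∂μ) / K := mean_mean _
  have hmeas : ∀ (σ : TribesPerms w) (x : TribesVar w → Bool),
      MeasurableSet {A | ¬ Outputs β (tribesCosts σ) x A (tribes w x)} :=
    fun σ x => (measurableSet_outputs _ _ _ _).compl
  have hmind : ∀ (σ : TribesPerms w) (x : TribesVar w → Bool), Measurable
      ({A | ¬ Outputs β (tribesCosts σ) x A (tribes w x)}.indicator
        (1 : OnlineAlg (TribesVar w) → ℝ≥0∞)) :=
    fun σ x => measurable_one.indicator (hmeas σ x)
  have hmcost : ∀ (σ : TribesPerms w) (x : TribesVar w → Bool), Measurable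
      fun A => onlineCost β (tribesCosts σ) x A := fun σ x => measurable_onlineCost _ _ _
  have h := lintegral_mono (μ := μ) fun A => card_le_error_add_onlineCost (β := β) hw hβ A
  rw [lintegral_const, measure_univ, mul_one, lintegral_add_right _ (by fun_prop),
    lintegral_const_mul _ (by fun_prop), lintegral_const_mul _ (by fun_prop),
    lintegral_finsetSum _ (by fun_prop), lintegral_finsetSum _ (by fun_prop)] at h
  simp only [lintegral_finsetSum _ fun x _ => hmind _ x,
    lintegral_finsetSum _ fun x _ => hmcost _ x, lintegral_indicator_one (hmeas _ _)] at h
  rw [herr, hcost, ← mul_div_assoc, ← mul_div_assoc, ← ENNReal.add_div,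
    ENNReal.le_div_iff_mul_le (Or.inl hK0) (Or.inl hKtop)]
  exact h

lemma le_tribesExpectedCost {ε₀ : ℝ≥0} (hε : ε₀ < 1 / 4) (hw : 1 ≤ w) (hβ : 0 < β)
    (μ : Measure (OnlineAlg (TribesVar w))) [IsProbabilityMeasure μ]
    (herr : tribesError w β μ ≤ (ε₀ : ℝ≥0∞)) :
    (((1 - 4 * ε₀) / 48 : ℝ≥0) : ℝ≥0∞) * (2 ^ w * w) ≤ tribesExpectedCost w β μ := by
  by_cases htop : tribesExpectedCost w β μ = ⊤
  · rw [htop]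
    exact le_top
  lift tribesExpectedCost w β μ to ℝ≥0 using htop with E hE
  have h := (le_tribesError_add_tribesExpectedCost hw hβ μ).trans
    (add_le_add (mul_le_mul_right herr _) le_rfl)
  rw [← hE] at h
  have h' : (2 ^ w * w : ℝ≥0) ≤ 4 * (2 ^ w * w) * ε₀ + 48 * E := by exact_mod_cast h
  have hε' : 4 * ε₀ ≤ 1 := by
    rw [lt_div_iff₀ (by norm_num)] at hε
    rw [mul_comm]
    exact hε.le
  have h'' : (1 - 4 * ε₀) / 48 * (2 ^ w * w : ℝ≥0) ≤ E := by
    rw [← NNReal.coe_le_coe] at h' ⊢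
    push_cast [NNReal.coe_sub hε'] at h' ⊢
    linarith
  exact_mod_cast h''

end Online

lemma log_two_pow_mul_le {w : ℕ} (hw : 1 ≤ w) : Real.log ((2 : ℝ) ^ w * w) ≤ 2 * w := by
  have hw' : (0 : ℝ) < w := by exact_mod_cast hw
  rw [Real.log_mul (by positivity) hw'.ne', Real.log_pow]
  have h1 := Real.log_le_sub_one_of_pos hw'
  have h2 := Real.log_two_lt_d9
  nlinarith

end PricedQuery

open PricedQuery
theorem theorem6p4 :
    (∃ C : ℝ≥0, ∀ w : ℕ, 1 ≤ w → ∀ σ : TribesPerms w,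
      optAvg 0 (tribes w) (tribesCosts σ) ≤ (C : ℝ≥0∞) * 2 ^ w) ∧
    (∀ ε₀ : ℝ≥0, ε₀ < 1 / 4 → ∃ κ : ℝ≥0, 0 < κ ∧
      ∀ (w : ℕ) (_ : 1 ≤ w) (β : ℝ≥0) (_ : 0 < β)
        (μ : Measure (OnlineAlg (TribesVar w))) [IsProbabilityMeasure μ],
        tribesError w β μ ≤ (ε₀ : ℝ≥0∞) →
          (κ : ℝ≥0∞) * (2 ^ w * (w : ℝ≥0∞)) ≤ tribesExpectedCost w β μ ∧
          ∀ σ : TribesPerms w,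
            (κ : ℝ≥0∞) * ENNReal.ofReal (Real.log ((2 : ℝ) ^ w * (w : ℝ))) *
                optAvg 0 (tribes w) (tribesCosts σ) ≤
              tribesExpectedCost w β μ) := by
  refine ⟨⟨4, fun w _ σ => optAvg_tribes_le w σ⟩, fun ε₀ hε => ?_⟩
  have hpos : 0 < (1 - 4 * ε₀) / 48 := by
    refine div_pos (tsub_pos_of_lt ?_) (by norm_num)
    rwa [lt_div_iff₀ (by norm_num), mul_comm] at hε
  -- The factor 8 pays for `log n ≤ 2 * w` and for the offline bound `4 * 2 ^ w`.
  refine ⟨(1 - 4 * ε₀) / 48 / 8, div_pos hpos (by norm_num), ?_⟩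
  intro w hw β hβ μ _ herr
  have hmain := le_tribesExpectedCost hε hw hβ μ herr
  set κ := (1 - 4 * ε₀) / 48
  have hκ : (κ : ℝ≥0∞) = ((κ / 8 : ℝ≥0) : ℝ≥0∞) * 8 := by
    rw [← ENNReal.coe_ofNat, ← ENNReal.coe_mul, div_mul_cancel₀ _ (by norm_num)]
  refine ⟨le_trans ?_ hmain, fun σ => le_trans ?_ hmain⟩
  · gcongr
    exact div_le_self zero_le (by norm_num)
  · have hlog : ENNReal.ofReal (Real.log ((2 : ℝ) ^ w * (w : ℝ))) ≤ 2 * w := by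
      refine (ENNReal.ofReal_le_ofReal (log_two_pow_mul_le hw)).trans (le_of_eq ?_)
      rw [ENNReal.ofReal_mul (by norm_num)]
      simp
    calc _ ≤ ((κ / 8 : ℝ≥0) : ℝ≥0∞) * (2 * w) * (4 * 2 ^ w) := by
          gcongr
          exact optAvg_tribes_le w σ
      _ = κ * (2 ^ w * w) := by
          rw [hκ]
          ring
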